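/- For each $k\in\mathbb N$ let $G_k$ be a connected (finite, simple, undirected) graph with vertex set $V_k$, edge set $E_k$ and $n_k=|V_k|$ vertices; apart from connectedness $G_k$ is arbitrary. For $\theta\in\mathbb R^{V_k}$ write $\|\nabla_{G_k}\theta\|_1=\sum_{\{u,v\}\in E_k}|\theta_u-\theta_v|$ for its total variation over $G_k$, and $\|\theta\|_{n_k}^2=\frac1{n_k}\sum_{v\in V_k}\theta_v^2$. Observe $y^{(k)}=\theta_0^{(k)}+\epsilon^{(k)}$, where the components of $\epsilon^{(k)}$ are i.i.d. with mean zero and satisfy $\mathbb P(|\epsilon^{(k)}_v|>s)\le M\exp(-s^2/(2\sigma^2))$ for all $s\ge 0$, for constants $M,\sigma>0$ that do not depend on $k$. Suppose that $t_k>0$, that $\theta_0^{(k)}\in \mathrm{BV}_{G_k}(t_k)=\{\theta:\|\nabla_{G_k}\theta\|_1\le t_k\}$, and that $n_k^{-1/2}=O(t_k)$ (which holds, for instance, if $t_k=t$ is a fixed positive constant). Let $$\hat\theta_{G_k}=\operatorname*{argmin}_{\theta\in\mathbb R^{V_k}}\ \tfrac12\|y^{(k)}-\theta\|_2^2+\lambda_k\|\nabla_{G_k}\theta\|_1$$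 be the fused lasso estimator over $G_k$ itself, with any choice of $\lambda_k\ge 0$ such that $\lambda_k\asymp t_k^{-1/3}n_k^{1/3}$. Then, as $k\to\infty$, $$\|\hat\theta_{G_k}-\theta_0^{(k)}\|_{n_k}^2=O_{\mathbb P}\big(t_k^{2/3}n_k^{-2/3}\big).$$ Here $a_k\asymp b_k$ means that $a_k/b_k$ is bounded and bounded away from zero for large $k$, and $A_k=O_{\mathbb P}(b_k)$ means that $A_k/b_k$ is bounded in probability. (The usual asymptotics, with $n\to\infty$ the number of vertices, is the case $n_k=k$, $k \geq 1$; no condition on how $n_k$ varies is needed.) -/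

import Mathlib

open MeasureTheory ProbabilityTheory Filter Asymptotics

namespace FusedLasso

noncomputable section

/-- The absolute difference of `θ` across an unordered pair of vertices. -/
def absDiff {V : Type*} (θ : V → ℝ) : Sym2 V → ℝ :=
  Sym2.lift ⟨fun u v => |θ u - θ v|, fun u v => abs_sub_comm (θ u) (θ v)⟩

open scoped Classical in
/-- The total variation `‖∇_G θ‖₁ = ∑_{e ∈ E} |θ_{e⁺} - θ_{e⁻}|` of `θ` over the graph `G`. -/
def totalVariation {V : Type*} [Fintype V] (G : SimpleGraph V) (θ : V → ℝ) : ℝ :=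
  ∑ e ∈ G.edgeFinset, absDiff θ e

/-- The bounded variation class `BV_G(t)`. -/
def BV {V : Type*} [Fintype V] (G : SimpleGraph V) (t : ℝ) : Set (V → ℝ) :=
  {θ | totalVariation G θ ≤ t}

/-- The fused lasso criterion `½ ‖y - θ‖₂² + lam ‖∇_G θ‖₁`. -/
def criterion {V : Type*} [Fintype V] (G : SimpleGraph V) (lam : ℝ) (y θ : V → ℝ) : ℝ :=
  1 / 2 * ∑ v, (y v - θ v) ^ 2 + lam * totalVariation G θ

/-- `θ` is the fused lasso estimate over `G` from data `y`: it minimizes the criterion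
over all of `V → ℝ` (the minimizer is unique, by strict convexity). -/
def IsFusedLasso {V : Type*} [Fintype V] (G : SimpleGraph V) (lam : ℝ) (y θ : V → ℝ) : Prop :=
  IsMinOn (criterion G lam y) Set.univ θ

/-- The scaled squared norm `‖x‖_n² = ‖x‖₂² / n`, where `n` is the number of coordinates. -/
def scaledSqNorm {V : Type*} [Fintype V] (x : V → ℝ) : ℝ :=
  (∑ v, x v ^ 2) / (Fintype.card V : ℝ)

/-- The components of `ε` are i.i.d., have mean zero and satisfy
`ℙ(|ε_v| > s) ≤ M exp(-s² / (2σ²))` for all `s ≥ 0`.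
(Integrability of `ε_v` follows from the tail bound.) -/
structure IsSubGaussianNoise {Ω V : Type*} [MeasurableSpace Ω] (P : Measure Ω)
    (M σ : ℝ) (ε : V → Ω → ℝ) : Prop where
  measurable : ∀ v, Measurable (ε v)
  indep : iIndepFun ε P
  identDistrib : ∀ v w, IdentDistrib (ε v) (ε w) P P
  mean_zero : ∀ v, ∫ ω, ε v ω ∂P = 0
  tail : ∀ v, ∀ s : ℝ, 0 ≤ s → P.real {ω | s < |ε v ω|} ≤ M * Real.exp (-s ^ 2 / (2 * σ ^ 2))

/-- `A_k = O_ℙ(b_k)`, where `A_k` is a real random variable on the `k`-th probability space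
`(Ω k, P k)` and `b_k` is a deterministic positive sequence: `A_k / b_k` is bounded in
probability. -/
def IsBigOP {Ω : ℕ → Type*} [∀ k, MeasurableSpace (Ω k)] (P : ∀ k, Measure (Ω k))
    (A : ∀ k, Ω k → ℝ) (b : ℕ → ℝ) : Prop :=
  ∀ η : ℝ, 0 < η → ∃ C : ℝ, 0 < C ∧ ∀ᶠ k in atTop, (P k).real {ω | C < |A k ω / b k|} ≤ η

end

end FusedLasso

/-! Connectedness lets the graph be traversed like a tree: the vertices can be ordered so that
variation along the order is at most twice the graph variation (`exists_ordering`). It then suffices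
to control the noise `z` on a chain.

On the chain, write `z i = δ i + u (i + 1) - u i` with `|u| ≤ a`. Summation by parts bounds the
pairing of `z` with `x` by `‖δ‖ ‖x‖`, a multiple of `a` times the variation of `x`, and a boundary
term. The path `u` is the random walk driven by `z`, kept in `[-a, a]` by a push `δ`. Hard
reflection would give a `‖δ‖²` of order `n / a`, which is too much. A logarithmic barrier, with
repulsion of order `β / distance` and `β` large against the noise moments, keeps the walk away from
the walls, so that the mean of `‖δ‖²` is of order `n / a ^ 2`. This is
`integral_confinedWalk_energy_le`, where the barrier serves as a Lyapunov function.

With `a = lam / 4` the variation term is absorbed by the penalty, and the basic inequality bounds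
the squared error by a multiple of `lam * t + n / lam ^ 2 + lam ^ 2 / n` with high probability. The
choice of `lam` balances the first two; the condition `n ^ (-1/2) = O(t)` makes the third no larger.
-/

namespace FusedLasso

noncomputable section

/-! ### The smoothed logarithmic wall. -/

/-- The derivative of `logEnvelope β`: the positive root `r` of `r ^ 2 = z * r + β`. -/
def envGrad (β z : ℝ) : ℝ := (z + √(z ^ 2 + 4 * β)) / 2

/-- The Moreau envelope of `p ↦ -β * log p`, up to reflection and an additive constant. -/
def logEnvelope (β z : ℝ) : ℝ := envGrad β z ^ 2 / 2 + β * Real.log (envGrad β z)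

section Envelope

variable {β : ℝ} (hβ : 0 < β)
include hβ

theorem envGrad_pos (z : ℝ) : 0 < envGrad β z := by
  have h : |z| < √(z ^ 2 + 4 * β) := by
    rw [← Real.sqrt_sq_eq_abs]
    exact Real.sqrt_lt_sqrt (sq_nonneg z) (by linarith)
  unfold envGrad
  linarith [neg_abs_le z]

theorem envGrad_sq (z : ℝ) : envGrad β z ^ 2 = z * envGrad β z + β := by
  have h := Real.sq_sqrt (show 0 ≤ z ^ 2 + 4 * β by positivity)
  unfold envGrad
  linear_combination h / 4

theorem sub_mul_envGrad_mul (z z' : ℝ) :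
    (z' - z) * (envGrad β z * envGrad β z') =
      (envGrad β z' - envGrad β z) * (envGrad β z * envGrad β z' + β) := by
  have h := envGrad_sq hβ z
  have h' := envGrad_sq hβ z'
  linear_combination envGrad β z' * h - envGrad β z * h'

theorem envGrad_mono {z z' : ℝ} (h : z ≤ z') : envGrad β z ≤ envGrad β z' := by
  have hr := envGrad_pos hβ z
  have hs := envGrad_pos hβ z'
  have hk := sub_mul_envGrad_mul hβ z z'
  have hp := mul_pos hr hs
  by_contra! hc
  have h1 : 0 ≤ (z' - z) * (envGrad β z * envGrad β z') := mul_nonneg (by linarith) hp.le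
  have h2 : (envGrad β z' - envGrad β z) * (envGrad β z * envGrad β z' + β) < 0 :=
    mul_neg_of_neg_of_pos (by linarith) (by linarith)
  linarith

theorem envGrad_sub_le {z z' : ℝ} (h : z ≤ z') : envGrad β z' - envGrad β z ≤ z' - z := by
  have hp := mul_pos (envGrad_pos hβ z) (envGrad_pos hβ z')
  have hk := sub_mul_envGrad_mul hβ z z'
  have hm := mul_nonneg (sub_nonneg.2 (envGrad_mono hβ h)) hβ.le
  refine le_of_mul_le_mul_right ?_ hp
  linarith

theorem envGrad_mul_envGrad_neg (z : ℝ) : envGrad β z * envGrad β (-z) = β := by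
  have h := Real.sq_sqrt (show 0 ≤ z ^ 2 + 4 * β by positivity)
  unfold envGrad
  rw [neg_sq]
  linear_combination h / 4

theorem envGrad_mul_le {z : ℝ} : envGrad β z * (-z) ≤ β := by
  have h := envGrad_sq hβ z
  nlinarith [sq_nonneg (envGrad β z)]

theorem envGrad_sq_le {z : ℝ} (hz : z ≤ 0) : envGrad β z ^ 2 ≤ β := by
  have h := envGrad_sq hβ z
  nlinarith [envGrad_pos hβ z]

/-- Parametrizing by the gradient `r`, with `z = r - β / r`, makes the Bregman divergence explicit.
Bounding its logarithm from either side gives the convexity and smoothness estimates. -/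
theorem logEnvelope_bregman (z z' : ℝ) :
    logEnvelope β z' - logEnvelope β z - envGrad β z * (z' - z) =
      (envGrad β z' - envGrad β z) ^ 2 / 2 +
        β * (Real.log (envGrad β z' / envGrad β z) + envGrad β z / envGrad β z' - 1) := by
  have hr := envGrad_pos hβ z
  have hs := envGrad_pos hβ z'
  have hz : z = envGrad β z - β / envGrad β z := by
    field_simp; linarith [envGrad_sq hβ z]
  have hz' : z' = envGrad β z' - β / envGrad β z' := by
    field_simp; linarith [envGrad_sq hβ z']
  have he : envGrad β z * (z' - z) =
      envGrad β z * ((envGrad β z' - β / envGrad β z') - (envGrad β z - β / envGrad β z)) := by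
    rw [← hz, ← hz']
  rw [he, Real.log_div hs.ne' hr.ne']
  unfold logEnvelope
  field_simp
  ring

theorem logEnvelope_tangent_le (z z' : ℝ) :
    logEnvelope β z + envGrad β z * (z' - z) ≤ logEnvelope β z' := by
  have hr := envGrad_pos hβ z
  have hs := envGrad_pos hβ z'
  have h := logEnvelope_bregman hβ z z'
  have hl := Real.one_sub_inv_le_log_of_pos (div_pos hs hr)
  rw [inv_div] at hl
  have := mul_nonneg hβ.le (show 0 ≤ Real.log (envGrad β z' / envGrad β z) +
    envGrad β z / envGrad β z' - 1 by linarith)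
  nlinarith [sq_nonneg (envGrad β z' - envGrad β z)]

theorem logEnvelope_bregman_le (z z' : ℝ) :
    logEnvelope β z' - logEnvelope β z - envGrad β z * (z' - z) ≤
      (envGrad β z' - envGrad β z) ^ 2 * (1 / 2 + β / (envGrad β z * envGrad β z')) := by
  have hr := envGrad_pos hβ z
  have hs := envGrad_pos hβ z'
  rw [logEnvelope_bregman hβ z z']
  have hl := Real.log_le_sub_one_of_pos (div_pos hs hr)
  have h1 : Real.log (envGrad β z' / envGrad β z) + envGrad β z / envGrad β z' - 1 ≤
      (envGrad β z' - envGrad β z) ^ 2 / (envGrad β z * envGrad β z') := by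
    calc _ ≤ envGrad β z' / envGrad β z - 1 + envGrad β z / envGrad β z' - 1 := by linarith
      _ = _ := by field_simp; ring
  have h2 := mul_le_mul_of_nonneg_left h1 hβ.le
  calc _ ≤ (envGrad β z' - envGrad β z) ^ 2 / 2 +
      β * ((envGrad β z' - envGrad β z) ^ 2 / (envGrad β z * envGrad β z')) := by linarith
    _ = _ := by ring

theorem sub_eq_envGrad_sub_mul (z z' : ℝ) :
    z' - z = (envGrad β z' - envGrad β z) * (1 + β / (envGrad β z * envGrad β z')) := by
  have hr := envGrad_pos hβ z
  have hs := envGrad_pos hβ z'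
  have := sub_mul_envGrad_mul hβ z z'
  field_simp
  linarith

theorem logEnvelope_le_add_half_sq (z z' : ℝ) :
    logEnvelope β z' ≤ logEnvelope β z + envGrad β z * (z' - z) + (z' - z) ^ 2 / 2 := by
  have hp := mul_pos (envGrad_pos hβ z) (envGrad_pos hβ z')
  have h := logEnvelope_bregman_le hβ z z'
  have hk : 0 < β / (envGrad β z * envGrad β z') := by positivity
  have he := sub_eq_envGrad_sub_mul hβ z z'
  set k := β / (envGrad β z * envGrad β z')
  set d := envGrad β z' - envGrad β z
  have h2 : d ^ 2 * (1 / 2 + k) ≤ (z' - z) ^ 2 / 2 := by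
    rw [he]
    nlinarith [mul_nonneg (sq_nonneg d) (sq_nonneg k)]
  linarith

/-- Unlike the uniform bound `logEnvelope_le_add_half_sq`, this one degenerates where the gradient
is small, so far from the wall the noise costs almost nothing. -/
theorem logEnvelope_le_add_sq_mul (z z' : ℝ) :
    logEnvelope β z' ≤ logEnvelope β z + envGrad β z * (z' - z) +
      (z' - z) ^ 2 * (envGrad β z * envGrad β z' / β) := by
  have hp := mul_pos (envGrad_pos hβ z) (envGrad_pos hβ z')
  have h := logEnvelope_bregman_le hβ z z'
  have hk : 0 < β / (envGrad β z * envGrad β z') := by positivity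
  have he := sub_eq_envGrad_sub_mul hβ z z'
  have hkinv : envGrad β z * envGrad β z' / β = (β / (envGrad β z * envGrad β z'))⁻¹ := by
    rw [inv_div]
  rw [hkinv]
  set k := β / (envGrad β z * envGrad β z')
  set d := envGrad β z' - envGrad β z
  have h2 : d ^ 2 * (1 / 2 + k) ≤ (z' - z) ^ 2 * k⁻¹ := by
    rw [he, mul_pow, mul_assoc]
    refine mul_le_mul_of_nonneg_left ?_ (sq_nonneg d)
    rw [← div_eq_mul_inv, le_div_iff₀ hk]
    nlinarith
  linarith

/-- By AM-GM, `r * s + β ≥ 2 * √(r * s)`, so `sub_mul_envGrad_mul` yields `2 * |s - r| ≤ τ * √(r *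
s)`: the gradient changes by a factor controlled by the step alone. -/
theorem envGrad_le_mul (hβ1 : 1 ≤ β) (z z' : ℝ) :
    envGrad β z' ≤ envGrad β z * (1 + |z' - z|) ^ 2 := by
  have hr := envGrad_pos hβ z
  have hs := envGrad_pos hβ z'
  have hk := sub_mul_envGrad_mul hβ z z'
  set r := envGrad β z
  set s := envGrad β z'
  set τ := |z' - z| with hτ
  have hτ0 : 0 ≤ τ := abs_nonneg _
  by_contra! hc
  have hrs : r < s := by nlinarith [mul_nonneg hr.le hτ0, mul_nonneg hr.le (sq_nonneg τ)]
  have hp := mul_pos hr hs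
  have h1 : (s - r) * (r * s + β) ≤ τ * (r * s) := by
    rw [← hk]; exact mul_le_mul_of_nonneg_right (le_abs_self _) hp.le
  have h1' : (s - r) * (r * s + 1) ≤ τ * (r * s) := by nlinarith
  have hτpos : 0 < τ := by
    by_contra! h0
    have : τ = 0 := le_antisymm h0 hτ0
    rw [this] at h1'
    nlinarith [mul_pos (sub_pos.2 hrs) hp]
  have hsq : ((s - r) * (r * s + 1)) ^ 2 ≤ (τ * (r * s)) ^ 2 :=
    pow_le_pow_left₀ (mul_nonneg (by linarith) (by linarith)) h1' 2
  have h4 : 4 * (s - r) ^ 2 * (r * s) ≤ τ ^ 2 * (r * s) * (r * s) := by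
    have : 4 * (r * s) ≤ (r * s + 1) ^ 2 := by nlinarith [sq_nonneg (r * s - 1)]
    nlinarith [mul_le_mul_of_nonneg_left this (sq_nonneg (s - r))]
  have h5 : 4 * (s - r) ^ 2 ≤ τ ^ 2 * (r * s) := le_of_mul_le_mul_right h4 hp
  have h6 : r * (2 * τ + τ ^ 2) < s - r := by nlinarith
  have h7 : (s - r) * (r * (2 * τ + τ ^ 2)) ≤ (s - r) ^ 2 := by
    rw [sq (s - r)]; exact mul_le_mul_of_nonneg_left h6.le (by linarith)
  have h8 : r * τ * (r * (2 * τ + τ ^ 2)) ≤ r * τ * (s - r) :=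
    mul_le_mul_of_nonneg_left h6.le (by positivity)
  have h9 : 0 < r ^ 2 * τ ^ 2 := by positivity
  have h10 : 0 ≤ r * τ ^ 2 * (s - r) := mul_nonneg (by positivity) (by linarith)
  have h11 : 0 < r ^ 2 * τ ^ 3 := by positivity
  nlinarith

end Envelope

/-! ### The two-sided barrier and its descent inequalities. -/

/-- A convex potential that confines to `[-a, a]`. -/
def barrier (β a y : ℝ) : ℝ := logEnvelope β (y - a) + logEnvelope β (-y - a)

/-- The derivative of `barrier β a`. -/
def barrierGrad (β a y : ℝ) : ℝ := envGrad β (y - a) - envGrad β (-y - a)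

theorem barrier_neg (β a y : ℝ) : barrier β a (-y) = barrier β a y := by
  unfold barrier; rw [neg_neg, add_comm]

theorem barrierGrad_neg (β a y : ℝ) : barrierGrad β a (-y) = -barrierGrad β a y := by
  unfold barrierGrad; rw [neg_neg]; ring

theorem barrierGrad_zero (β a : ℝ) : barrierGrad β a 0 = 0 := by simp [barrierGrad]

section Barrier

variable {β a : ℝ} (hβ : 0 < β)
include hβ

theorem barrierGrad_mono {y y' : ℝ} (h : y ≤ y') : barrierGrad β a y ≤ barrierGrad β a y' :=
  sub_le_sub (envGrad_mono hβ (by linarith)) (envGrad_mono hβ (by linarith))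

theorem barrier_zero_le (y : ℝ) : barrier β a 0 ≤ barrier β a y := by
  have h1 := logEnvelope_tangent_le hβ (0 - a) (y - a)
  have h2 := logEnvelope_tangent_le hβ (-0 - a) (-y - a)
  simp only [neg_zero] at h2
  unfold barrier
  simp only [neg_zero]
  linarith

/-- A gradient step on one envelope is a proximal step for the logarithm, so it lands at distance `β
/ r` inside its wall. The opposite wall pushes by at most `β / r`. -/
theorem abs_sub_barrierGrad_le (ha : 0 ≤ a) (y : ℝ) : |y - barrierGrad β a y| ≤ a := by
  have h1 := envGrad_pos hβ (y - a)
  have h2 := envGrad_pos hβ (-y - a)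
  have hp : envGrad β (y - a) * envGrad β (-y - a) ≤ β := by
    calc _ ≤ envGrad β (y - a) * envGrad β (-(y - a)) :=
          mul_le_mul_of_nonneg_left (envGrad_mono hβ (by linarith)) h1.le
      _ = β := envGrad_mul_envGrad_neg hβ _
  have e1 := envGrad_sq hβ (y - a)
  have e2 := envGrad_sq hβ (-y - a)
  unfold barrierGrad
  rw [abs_le]
  constructor
  · refine le_of_mul_le_mul_right ?_ h2
    nlinarith
  · refine le_of_mul_le_mul_right ?_ h1
    nlinarith

/-- Near-wall smoothness costs `f ^ 2 / 2` and the far wall `f ^ 2 / 8`, leaving `3 / 8 * f ^ 2` of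
the first-order decrease `f ^ 2`. An eighth of it is exchanged for the gradient at the new point, to
pay for the next noise increment. -/
theorem barrier_descent_of_nonneg (ha : 8 * √β ≤ a) {y : ℝ} (hy : 0 ≤ y) :
    barrier β a (y - barrierGrad β a y) + barrierGrad β a (y - barrierGrad β a y) ^ 2 / 8 +
      barrierGrad β a y ^ 2 / 4 ≤ barrier β a y := by
  have hsq := Real.sqrt_pos.2 hβ
  have ha0 : 0 < a := by linarith
  set f := barrierGrad β a y with hf
  set w := y - f with hw
  have hw_abs : |w| ≤ a := abs_sub_barrierGrad_le hβ ha0.le y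
  have hf0 : 0 ≤ f := by
    rw [← barrierGrad_zero β a]; exact barrierGrad_mono hβ hy
  have hf2 : f ≤ 2 * y := by
    have := envGrad_sub_le hβ (show -y - a ≤ y - a by linarith)
    rw [hf]; unfold barrierGrad; linarith
  have hfw : barrierGrad β a w ^ 2 ≤ f ^ 2 := by
    apply sq_le_sq'
    · rw [hf, ← barrierGrad_neg]; exact barrierGrad_mono hβ (by linarith)
    · exact barrierGrad_mono hβ (by linarith)
  have h1 := logEnvelope_le_add_half_sq hβ (y - a) (w - a)
  have h2 := logEnvelope_le_add_sq_mul hβ (-y - a) (-w - a)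
  have hr := envGrad_pos hβ (-y - a)
  have hs := envGrad_pos hβ (-w - a)
  have hs1 : envGrad β (-w - a) ≤ √β :=
    Real.le_sqrt_of_sq_le (envGrad_sq_le hβ (by linarith [(abs_le.1 hw_abs).1]))
  have hr1 : envGrad β (-y - a) * a ≤ β := by
    have := envGrad_mul_le hβ (z := -y - a)
    nlinarith
  have hk : envGrad β (-y - a) * envGrad β (-w - a) / β ≤ 1 / 8 := by
    rw [div_le_iff₀ hβ]
    have : envGrad β (-w - a) * 8 ≤ a := by linarith
    nlinarith
  have h3 : (-w - a - (-y - a)) ^ 2 * (envGrad β (-y - a) * envGrad β (-w - a) / β) ≤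
      (-w - a - (-y - a)) ^ 2 * (1 / 8) := mul_le_mul_of_nonneg_left hk (sq_nonneg _)
  have e1 : w - a - (y - a) = -f := by rw [hw]; ring
  have e2 : -w - a - (-y - a) = f := by rw [hw]; ring
  rw [e1] at h1
  rw [e2] at h2 h3
  have e3 : f = envGrad β (y - a) - envGrad β (-y - a) := rfl
  have e4 : f * f = (envGrad β (y - a) - envGrad β (-y - a)) * f := by rw [← e3]
  unfold barrier
  nlinarith

theorem barrier_descent (ha : 8 * √β ≤ a) (y : ℝ) :
    barrier β a (y - barrierGrad β a y) + barrierGrad β a (y - barrierGrad β a y) ^ 2 / 8 +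
      barrierGrad β a y ^ 2 / 4 ≤ barrier β a y := by
  rcases le_total 0 y with hy | hy
  · exact barrier_descent_of_nonneg hβ ha hy
  · have h := barrier_descent_of_nonneg hβ ha (neg_nonneg.2 hy)
    have e : -y - barrierGrad β a (-y) = -(y - barrierGrad β a y) := by
      rw [barrierGrad_neg]; ring
    rw [e] at h
    simpa only [barrier_neg, barrierGrad_neg, neg_sq] using h

/-- The cost of a noise step before the push. Its first-order term has mean zero; the curvature is
controlled by the squared gradients of the two walls. -/
theorem barrier_add_le (hβ1 : 1 ≤ β) (ha : 0 < a) (u e : ℝ) :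
    barrier β a (u + e) ≤ barrier β a u + barrierGrad β a u * e +
      (2 * barrierGrad β a u ^ 2 + 3 * (β / a) ^ 2) * (e ^ 2 * (1 + |e|) ^ 2 / β) := by
  have key : ∀ z z' : ℝ, |z' - z| = |e| → logEnvelope β z' ≤ logEnvelope β z +
      envGrad β z * (z' - z) + envGrad β z ^ 2 * (e ^ 2 * (1 + |e|) ^ 2 / β) := by
    intro z z' h
    have h1 := logEnvelope_le_add_sq_mul hβ z z'
    have h2 := envGrad_le_mul hβ hβ1 z z'
    rw [h] at h2
    have h3 : (z' - z) ^ 2 = e ^ 2 := by rw [← sq_abs, h, sq_abs]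
    rw [h3] at h1
    have h4 : e ^ 2 * (envGrad β z * envGrad β z' / β) ≤
        e ^ 2 * (envGrad β z * (envGrad β z * (1 + |e|) ^ 2) / β) := by
      have := (envGrad_pos hβ z).le
      gcongr
    calc _ ≤ _ := h1
      _ ≤ _ := add_le_add_right h4 _
      _ = _ := by ring
  have h1 := key (u - a) (u + e - a) (by congr 1; ring)
  have h2 := key (-u - a) (-(u + e) - a) (by rw [← abs_neg e]; congr 1; ring)
  have hX : 0 ≤ e ^ 2 * (1 + |e|) ^ 2 / β := by positivity
  -- The farther wall contributes `s ≤ β / a`, and `r ^ 2 + s ^ 2 ≤ 2 * (r - s) ^ 2 + 3 * s ^ 2`.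
  have hr : envGrad β (u - a) ^ 2 + envGrad β (-u - a) ^ 2 ≤
      2 * barrierGrad β a u ^ 2 + 3 * (β / a) ^ 2 := by
    have p1 := envGrad_pos hβ (u - a)
    have p2 := envGrad_pos hβ (-u - a)
    unfold barrierGrad
    rcases le_total 0 u with hu | hu
    · have : envGrad β (-u - a) ≤ β / a := by
        rw [le_div_iff₀ ha]
        nlinarith [envGrad_mul_le hβ (z := -u - a)]
      have := pow_le_pow_left₀ p2.le this 2
      nlinarith [sq_nonneg (envGrad β (u - a) - 2 * envGrad β (-u - a))]
    · have : envGrad β (u - a) ≤ β / a := by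
        rw [le_div_iff₀ ha]
        nlinarith [envGrad_mul_le hβ (z := u - a)]
      have := pow_le_pow_left₀ p1.le this 2
      nlinarith [sq_nonneg (envGrad β (-u - a) - 2 * envGrad β (u - a))]
  have h3 := mul_le_mul_of_nonneg_right hr hX
  unfold barrier
  have e1 : barrierGrad β a u * e =
    envGrad β (u - a) * (u + e - a - (u - a)) + envGrad β (-u - a) * (-(u + e) - a - (-u - a)) := by
    unfold barrierGrad; ring
  rw [e1]
  linarith

end Barrier

@[fun_prop]
theorem continuous_envGrad (β : ℝ) : Continuous (envGrad β) := by
  unfold envGrad; fun_prop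

theorem continuous_barrierGrad (β a : ℝ) : Continuous (barrierGrad β a) := by
  unfold barrierGrad; fun_prop

theorem continuous_barrier {β : ℝ} (hβ : 0 < β) (a : ℝ) : Continuous (barrier β a) := by
  have h : Continuous (logEnvelope β) := by
    unfold logEnvelope
    exact (((continuous_envGrad β).pow 2).div_const 2).add
      (continuous_const.mul ((continuous_envGrad β).log fun z => (envGrad_pos hβ z).ne'))
  unfold barrier; fun_prop

/-! ### Ordering the vertices of a connected graph. -/

/-- The total variation of `θ` along a list of vertices. -/
def listVariation {V : Type*} (θ : V → ℝ) : List V → ℝ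
  | [] => 0
  | [_] => 0
  | u :: v :: l => |θ u - θ v| + listVariation θ (v :: l)

/-- The detour from `w` to `v` and back crosses their difference twice. -/
theorem listVariation_insert_le {V : Type*} (θ : V → ℝ) (w v : V) (l₂ : List V) :
    ∀ l₁ : List V, listVariation θ (l₁ ++ w :: v :: l₂) ≤
      listVariation θ (l₁ ++ w :: l₂) + 2 * |θ w - θ v|
  | [] => by
    cases l₂ with
    | nil => simp only [List.nil_append, listVariation]; linarith [abs_nonneg (θ w - θ v)]
    | cons x l =>
      simp only [List.nil_append, listVariation]
      have := abs_sub_le (θ v) (θ w) (θ x)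
      rw [abs_sub_comm (θ v) (θ w)] at this
      linarith
  | [x] => by
    have := listVariation_insert_le θ w v l₂ []
    simp only [List.cons_append, List.nil_append, listVariation] at this ⊢
    linarith
  | x :: y :: l => by
    have := listVariation_insert_le θ w v l₂ (y :: l)
    simp only [List.cons_append, listVariation] at this ⊢
    linarith

theorem listVariation_eq_sum {V : Type*} (θ : V → ℝ) (d : V) :
    ∀ l : List V, listVariation θ l =
      ∑ i ∈ Finset.range (l.length - 1), |θ (l.getD i d) - θ (l.getD (i + 1) d)|
  | [] => by simp [listVariation]
  | [_] => by simp [listVariation]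
  | u :: v :: l => by
    have h := listVariation_eq_sum θ d (v :: l)
    rw [listVariation, h]
    simp only [List.length_cons, Nat.add_sub_cancel]
    rw [Finset.sum_range_succ', add_comm]
    simp

theorem absDiff_nonneg {V : Type*} (θ : V → ℝ) (e : Sym2 V) : 0 ≤ absDiff θ e := by
  induction e with | _ u v => exact abs_nonneg _

section Graph

variable {V : Type*} [Fintype V] {G : SimpleGraph V}

theorem totalVariation_sub_le (θ θ' : V → ℝ) :
    totalVariation G (fun v => θ v - θ' v) ≤ totalVariation G θ + totalVariation G θ' := by
  unfold totalVariation
  rw [← Finset.sum_add_distrib]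
  refine Finset.sum_le_sum fun e _ => ?_
  induction e with | _ u v =>
  change |θ u - θ' u - (θ v - θ' v)| ≤ |θ u - θ v| + |θ' u - θ' v|
  have : θ u - θ' u - (θ v - θ' v) = (θ u - θ v) - (θ' u - θ' v) := by ring
  rw [this]
  exact abs_sub _ _

open scoped Classical in
-- The list grows along an edge leaving it, the new vertex being inserted right after its neighbour.
-- That edge was not inside the old list, so each edge is charged at most once.
theorem exists_partial_ordering (hG : G.Connected) (m : ℕ) (hm : m + 1 ≤ Fintype.card V) :
    ∃ l : List V, l.Nodup ∧ l.length = m + 1 ∧ ∀ θ : V → ℝ, listVariation θ l ≤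
      2 * ∑ e ∈ G.edgeFinset with (∀ x ∈ e, x ∈ l), absDiff θ e := by
  induction m with
  | zero =>
    obtain ⟨v⟩ := hG.nonempty
    refine ⟨[v], by simp, by simp, fun θ => ?_⟩
    have := Finset.sum_nonneg (s := {e ∈ G.edgeFinset | ∀ x ∈ e, x ∈ [v]})
      fun e _ => absDiff_nonneg θ e
    rw [listVariation]
    linarith
  | succ m ih =>
    obtain ⟨l, hl, hlen, hvar⟩ := ih (by omega)
    have hne : ∃ z, z ∉ l := by
      by_contra! h
      have h1 : Fintype.card V ≤ l.toFinset.card := by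
        rw [← Finset.card_univ]
        exact Finset.card_le_card fun x _ => by simpa using h x
      rw [List.toFinset_card_of_nodup hl] at h1
      omega
    obtain ⟨z, hz⟩ := hne
    obtain ⟨a, ha⟩ : ∃ a, a ∈ l := List.exists_mem_of_length_pos (by omega)
    obtain ⟨p⟩ := hG.preconnected a z
    obtain ⟨d, -, hd1, hd2⟩ := p.exists_boundary_dart {x | x ∈ l} ha hz
    obtain ⟨l₁, l₂, rfl⟩ := List.append_of_mem (show d.fst ∈ l from hd1)
    have hd2' : d.snd ∉ l₁ ++ d.fst :: l₂ := hd2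
    have hperm : (l₁ ++ d.fst :: d.snd :: l₂).Perm (d.snd :: (l₁ ++ d.fst :: l₂)) := by
      have := List.perm_middle (a := d.snd) (l₁ := l₁ ++ [d.fst]) (l₂ := l₂)
      simpa using this
    refine ⟨l₁ ++ d.fst :: d.snd :: l₂, ?_, ?_, fun θ => ?_⟩
    · rw [hperm.nodup_iff, List.nodup_cons]
      exact ⟨hd2', hl⟩
    · rw [hperm.length_eq, List.length_cons, hlen]
    · refine (listVariation_insert_le θ _ _ _ _).trans ?_
      have hmem : ∀ x, x ∈ l₁ ++ d.fst :: d.snd :: l₂ ↔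
          x = d.snd ∨ x ∈ l₁ ++ d.fst :: l₂ := fun x => by
        rw [hperm.mem_iff, List.mem_cons]
      have hnot : s(d.fst, d.snd) ∉
          {e ∈ G.edgeFinset | ∀ x ∈ e, x ∈ l₁ ++ d.fst :: l₂} := by
        intro h
        exact hd2' ((Finset.mem_filter.1 h).2 _ (Sym2.mem_mk_right _ _))
      have hsub : insert s(d.fst, d.snd) {e ∈ G.edgeFinset | ∀ x ∈ e, x ∈ l₁ ++ d.fst :: l₂} ⊆
          {e ∈ G.edgeFinset | ∀ x ∈ e, x ∈ l₁ ++ d.fst :: d.snd :: l₂} := by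
        intro e he
        rw [Finset.mem_insert] at he
        rw [Finset.mem_filter]
        rcases he with rfl | he
        · refine ⟨by simp, fun x hx => ?_⟩
          rw [Sym2.mem_iff] at hx
          rcases hx with rfl | rfl <;> simp
        · rw [Finset.mem_filter] at he
          exact ⟨he.1, fun x hx => (hmem x).2 (Or.inr (he.2 x hx))⟩
      have h1 := Finset.sum_le_sum_of_subset_of_nonneg hsub
        fun e _ _ => absDiff_nonneg θ e
      rw [Finset.sum_insert hnot] at h1
      have h2 : absDiff θ s(d.fst, d.snd) = |θ d.fst - θ d.snd| := rfl
      rw [h2] at h1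
      linarith [hvar θ]

/-- The vertices of a connected graph can be ordered so that the total variation along the order
is at most twice the total variation over the graph. -/
theorem exists_ordering (hG : G.Connected) :
    ∃ e : Fin (Fintype.card V) ≃ V, ∀ θ : V → ℝ, ∀ x : ℕ → ℝ,
      (∀ i : Fin (Fintype.card V), x i = θ (e i)) →
      ∑ i ∈ Finset.range (Fintype.card V - 1), |x (i + 1) - x i| ≤ 2 * totalVariation G θ := by
  classical
  obtain ⟨v⟩ := hG.nonempty
  have hpos : 0 < Fintype.card V := Fintype.card_pos_iff.2 ⟨v⟩
  obtain ⟨l, hl, hlen, hvar⟩ := exists_partial_ordering hG (Fintype.card V - 1) (by omega)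
  have hlen' : l.length = Fintype.card V := by omega
  have hinj : Function.Injective fun i : Fin (Fintype.card V) => l.get (i.cast hlen'.symm) :=
    (List.nodup_iff_injective_get.1 hl).comp (Fin.cast_injective _)
  have hbij := (Fintype.bijective_iff_injective_and_card _).2 ⟨hinj, Fintype.card_fin _⟩
  refine ⟨Equiv.ofBijective _ hbij, fun θ x hx => ?_⟩
  have h1 := hvar θ
  rw [listVariation_eq_sum θ v, hlen'] at h1
  have h2 : ∑ e ∈ G.edgeFinset with (∀ x ∈ e, x ∈ l), absDiff θ e ≤ totalVariation G θ :=
    Finset.sum_le_sum_of_subset_of_nonneg (Finset.filter_subset _ _)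
      fun e _ _ => absDiff_nonneg θ e
  have h3 : ∀ i < Fintype.card V, x i = θ (l.getD i v) := fun i hi => by
    rw [hx ⟨i, hi⟩, List.getD_eq_getElem l v (by omega)]
    rfl
  calc _ = ∑ i ∈ Finset.range (Fintype.card V - 1),
        |θ (l.getD i v) - θ (l.getD (i + 1) v)| := by
        refine Finset.sum_congr rfl fun i hi => ?_
        have := Finset.mem_range.1 hi
        rw [h3 i (by omega), h3 (i + 1) (by omega), abs_sub_comm]
    _ ≤ _ := by linarith

end Graph

/-! ### Summation by parts and the energy of the confined walk. -/

/-- The walk with increments `x`, pushed back at each step by the gradient of `barrier β a`. -/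
def confinedWalk (β a : ℝ) (x : ℕ → ℝ) : ℕ → ℝ
  | 0 => 0
  | i + 1 => confinedWalk β a x i + x i - barrierGrad β a (confinedWalk β a x i + x i)

theorem abs_confinedWalk_le {β a : ℝ} (hβ : 0 < β) (ha : 0 ≤ a) (x : ℕ → ℝ) :
    ∀ i, |confinedWalk β a x i| ≤ a
  | 0 => by simpa [confinedWalk] using ha
  | _ + 1 => abs_sub_barrierGrad_le hβ ha _

section Duality

theorem sum_mul_eq_of_decomposition (z x u δ : ℕ → ℝ) (hu0 : u 0 = 0)
    (hz : ∀ i, z i = δ i + u (i + 1) - u i) (N : ℕ) :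
    ∑ i ∈ Finset.range (N + 1), z i * x i = ∑ i ∈ Finset.range (N + 1), δ i * x i +
      u (N + 1) * x N - ∑ i ∈ Finset.range N, u (i + 1) * (x (i + 1) - x i) := by
  induction N with
  | zero => simp [hz, hu0, add_mul]
  | succ N ih =>
    rw [Finset.sum_range_succ, ih, Finset.sum_range_succ _ (N + 1),
      Finset.sum_range_succ (fun i => u (i + 1) * (x (i + 1) - x i)) N, hz (N + 1)]
    ring

theorem abs_last_sub_le (x : ℕ → ℝ) (N i : ℕ) (hi : i ≤ N) :
    |x N| ≤ |x i| + ∑ j ∈ Finset.range N, |x (j + 1) - x j| := by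
  induction N, hi using Nat.le_induction with
  | base => linarith [Finset.sum_nonneg (s := Finset.range i) fun j _ => abs_nonneg (x (j + 1) - x j)]
  | succ N _ ih =>
    rw [Finset.sum_range_succ]
    have := abs_add_le (x N) (x (N + 1) - x N)
    rw [add_sub_cancel] at this
    linarith

/-- Averaging `abs_last_sub_le` over `i` and applying Cauchy-Schwarz handles the boundary term of
the summation by parts. -/
theorem abs_last_le (x : ℕ → ℝ) (N : ℕ) :
    |x N| ≤ √(∑ i ∈ Finset.range (N + 1), x i ^ 2) / √(N + 1 : ℝ) +
      ∑ j ∈ Finset.range N, |x (j + 1) - x j| := by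
  have hN : (0 : ℝ) < N + 1 := by positivity
  have h1 := Finset.sum_le_sum fun i (hi : i ∈ Finset.range (N + 1)) =>
    abs_last_sub_le x N i (by have := Finset.mem_range.1 hi; omega)
  rw [Finset.sum_add_distrib, Finset.sum_const, Finset.sum_const, Finset.card_range,
    nsmul_eq_mul, nsmul_eq_mul] at h1
  have h2 := Real.sum_mul_le_sqrt_mul_sqrt (Finset.range (N + 1)) (fun _ => (1 : ℝ)) fun i => |x i|
  simp only [one_mul, one_pow, Finset.sum_const, Finset.card_range, nsmul_eq_mul, mul_one,
    sq_abs] at h2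
  push_cast at h1 h2
  have h3 : √(N + 1 : ℝ) * √(N + 1 : ℝ) = N + 1 := Real.mul_self_sqrt hN.le
  have h4 : 0 < √(N + 1 : ℝ) := Real.sqrt_pos.2 hN
  rw [← sub_le_iff_le_add, le_div_iff₀ h4]
  refine le_of_mul_le_mul_right ?_ h4
  calc _ = (N + 1) * |x N| - (N + 1) * ∑ j ∈ Finset.range N, |x (j + 1) - x j| := by
        linear_combination (|x N| - ∑ j ∈ Finset.range N, |x (j + 1) - x j|) * h3
    _ ≤ _ := by linarith

theorem abs_sum_mul_le_of_decomposition (z x u δ : ℕ → ℝ) {a : ℝ} (hu0 : u 0 = 0)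
    (hu : ∀ i, |u i| ≤ a) (hz : ∀ i, z i = δ i + u (i + 1) - u i) (N : ℕ) :
    |∑ i ∈ Finset.range (N + 1), z i * x i| ≤
      (√(∑ i ∈ Finset.range (N + 1), δ i ^ 2) + a / √(N + 1 : ℝ)) *
        √(∑ i ∈ Finset.range (N + 1), x i ^ 2) +
      2 * a * ∑ i ∈ Finset.range N, |x (i + 1) - x i| := by
  have ha : 0 ≤ a := (abs_nonneg _).trans (hu 0)
  rw [sum_mul_eq_of_decomposition z x u δ hu0 hz]
  have h1 : |∑ i ∈ Finset.range (N + 1), δ i * x i| ≤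
      √(∑ i ∈ Finset.range (N + 1), δ i ^ 2) * √(∑ i ∈ Finset.range (N + 1), x i ^ 2) :=
    (Finset.abs_sum_le_sum_abs _ _).trans <| by
      simpa only [abs_mul, sq_abs] using Real.sum_mul_le_sqrt_mul_sqrt (Finset.range (N + 1))
        (fun i => |δ i|) fun i => |x i|
  have h2 : |u (N + 1) * x N| ≤ a * (√(∑ i ∈ Finset.range (N + 1), x i ^ 2) / √(N + 1 : ℝ) +
      ∑ j ∈ Finset.range N, |x (j + 1) - x j|) := by
    rw [abs_mul]
    exact mul_le_mul (hu _) (abs_last_le x N) (abs_nonneg _) ha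
  have h3 : |∑ i ∈ Finset.range N, u (i + 1) * (x (i + 1) - x i)| ≤
      a * ∑ i ∈ Finset.range N, |x (i + 1) - x i| := by
    rw [Finset.mul_sum]
    refine (Finset.abs_sum_le_sum_abs _ _).trans (Finset.sum_le_sum fun i _ => ?_)
    rw [abs_mul]
    exact mul_le_mul_of_nonneg_right (hu _) (abs_nonneg _)
  calc _ ≤ _ := abs_sub _ _
    _ ≤ _ := add_le_add ((abs_add_le _ _).trans (add_le_add h1 h2)) h3
    _ = _ := by ring

end Duality

section Energy

variable {Ω : Type*} [mΩ : MeasurableSpace Ω]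

theorem integrable_comp_of_bounded {P : Measure Ω} [IsFiniteMeasure P] {h : ℝ → ℝ}
    (hh : Continuous h) {U : Ω → ℝ} (hU : Measurable U) {a : ℝ} (ha : ∀ ω, |U ω| ≤ a) :
    Integrable (fun ω => h (U ω)) P := by
  obtain ⟨C, hC⟩ := (isCompact_Icc (a := -a) (b := a)).exists_bound_of_continuousOn hh.continuousOn
  exact Integrable.of_bound (hh.measurable.comp hU).aestronglyMeasurable C
    (Eventually.of_forall fun ω => hC _ (abs_le.1 (ha ω)))

omit mΩ in
-- The position before step `i` depends only on earlier increments, hence is independent of `x i`.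
theorem measurable_confinedWalk_iSup (β a : ℝ) (x : ℕ → Ω → ℝ) (i : ℕ) :
    Measurable[⨆ j ∈ Set.Iio i, MeasurableSpace.comap (x j) inferInstance]
      fun ω => confinedWalk β a (fun j => x j ω) i := by
  induction i with
  | zero => exact measurable_const
  | succ i ih =>
    have h1 : Measurable[⨆ j ∈ Set.Iio (i + 1), MeasurableSpace.comap (x j) inferInstance]
        fun ω => confinedWalk β a (fun j => x j ω) i :=
      ih.mono (biSup_mono fun j hj => Set.mem_Iio.2 ((Set.mem_Iio.1 hj).trans (Nat.lt_succ_self i)))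
        le_rfl
    have h2 : Measurable[⨆ j ∈ Set.Iio (i + 1), MeasurableSpace.comap (x j) inferInstance] (x i) :=
      (comap_measurable (x i)).mono
        (le_biSup (fun j => MeasurableSpace.comap (x j) inferInstance)
          (Set.mem_Iio.2 (Nat.lt_succ_self i))) le_rfl
    have h3 : Measurable fun y : ℝ => y - barrierGrad β a y :=
      (continuous_id.sub (continuous_barrierGrad β a)).measurable
    exact h3.comp (h1.add h2)

theorem measurable_confinedWalk (β a : ℝ) {x : ℕ → Ω → ℝ} (hx : ∀ j, Measurable (x j)) (i : ℕ) :
    Measurable fun ω => confinedWalk β a (fun j => x j ω) i :=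
  (measurable_confinedWalk_iSup β a x i).mono
    (iSup₂_le fun j _ => (hx j).comap_le) le_rfl

theorem integral_confinedWalk_energy_le {P : Measure Ω} [IsProbabilityMeasure P] {β a : ℝ}
    (hβ : 1 ≤ β) (ha : 8 * √β ≤ a) {x : ℕ → Ω → ℝ} (hx : ∀ j, Measurable (x j)) {n : ℕ}
    (hind : ∀ i < n, Indep (⨆ j ∈ Set.Iio i, MeasurableSpace.comap (x j) inferInstance)
      (MeasurableSpace.comap (x i) inferInstance) P)
    (hint : ∀ i, Integrable (fun ω => x i ω ^ 2 * (1 + |x i ω|) ^ 2) P)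
    (hmom : ∀ i, 16 * ∫ ω, x i ω ^ 2 * (1 + |x i ω|) ^ 2 ∂P ≤ β)
    (hint1 : ∀ i, Integrable (x i) P) (hmean : ∀ i, ∫ ω, x i ω ∂P = 0) :
    Integrable (fun ω => ∑ i ∈ Finset.range n,
      barrierGrad β a (confinedWalk β a (fun j => x j ω) i + x i ω) ^ 2) P ∧
    ∫ ω, ∑ i ∈ Finset.range n,
      barrierGrad β a (confinedWalk β a (fun j => x j ω) i + x i ω) ^ 2 ∂P ≤ n * (β / a) ^ 2 * β := by
  have hβ0 : 0 < β := by linarith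
  have ha0 : 0 < a := by linarith [Real.sqrt_pos.2 hβ0]
  set U : ℕ → Ω → ℝ := fun i ω => confinedWalk β a (fun j => x j ω) i with hU
  have hUm : ∀ i, Measurable (U i) := measurable_confinedWalk β a hx
  have hUa : ∀ i ω, |U i ω| ≤ a := fun i ω => abs_confinedWalk_le hβ0 ha0.le _ i
  have hfc := continuous_barrierGrad β a
  have hqc := continuous_barrier hβ0 a
  set δ : ℕ → Ω → ℝ := fun i ω => barrierGrad β a (U i ω + x i ω) ^ 2 with hδ
  set X : ℕ → Ω → ℝ := fun i ω => x i ω ^ 2 * (1 + |x i ω|) ^ 2 with hX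
  have hf2 : ∀ i, Integrable (fun ω => barrierGrad β a (U i ω) ^ 2) P := fun i =>
    integrable_comp_of_bounded (hfc.pow 2) (hUm i) (hUa i)
  have hq : ∀ i, Integrable (fun ω => barrier β a (U i ω)) P := fun i =>
    integrable_comp_of_bounded hqc (hUm i) (hUa i)
  have hδm : ∀ i, Measurable (δ i) := fun i =>
    (hfc.measurable.comp ((hUm i).add (hx i))).pow_const 2
  have hδi : ∀ i, Integrable (δ i) P := fun i => by
    have hb : Integrable (fun ω => 8 * a ^ 2 + 2 * X i ω) P :=
      (integrable_const _).add ((hint i).const_mul 2)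
    refine hb.mono' (hδm i).aestronglyMeasurable (Eventually.of_forall fun ω => ?_)
    have h1 : |barrierGrad β a (U i ω + x i ω)| ≤ 2 * a + |x i ω| := by
      have h2 := hUa (i + 1) ω
      have h3 : U (i + 1) ω = U i ω + x i ω - barrierGrad β a (U i ω + x i ω) := rfl
      have h4 : barrierGrad β a (U i ω + x i ω) = U i ω + x i ω - U (i + 1) ω := by
        rw [h3]; ring
      rw [h4]
      have := abs_sub (U i ω + x i ω) (U (i + 1) ω)
      have := abs_add_le (U i ω) (x i ω)
      linarith [hUa i ω]
    have h5 : δ i ω ≤ (2 * a + |x i ω|) ^ 2 := by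
      rw [hδ]; dsimp only
      rw [← sq_abs]; exact pow_le_pow_left₀ (abs_nonneg _) h1 2
    have h6 : x i ω ^ 2 ≤ X i ω :=
      le_mul_of_one_le_right (sq_nonneg _) (one_le_pow₀ (by linarith [abs_nonneg (x i ω)]))
    rw [Real.norm_of_nonneg (sq_nonneg _)]
    nlinarith [sq_nonneg (2 * a - |x i ω|), sq_abs (x i ω)]
  have hmeanU : ∀ i < n, Integrable (fun ω => barrierGrad β a (U i ω) * x i ω) P ∧
      ∫ ω, barrierGrad β a (U i ω) * x i ω ∂P = 0 := fun i hi => by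
    have hi1 : IndepFun (fun ω => barrierGrad β a (U i ω)) (x i) P := by
      rw [IndepFun_iff_Indep]
      exact indep_of_indep_of_le_left (hind i hi)
        (hfc.measurable.comp (measurable_confinedWalk_iSup β a x i)).comap_le
    have hfi := integrable_comp_of_bounded (P := P) hfc (hUm i) (hUa i)
    refine ⟨hi1.integrable_mul hfi (hint1 i), ?_⟩
    rw [hi1.integral_fun_mul_eq_mul_integral hfi.aestronglyMeasurable (hint1 i).aestronglyMeasurable,
      hmean, mul_zero]
  have hXU : ∀ i < n, Integrable (fun ω => barrierGrad β a (U i ω) ^ 2 * X i ω) P ∧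
      ∫ ω, barrierGrad β a (U i ω) ^ 2 * X i ω ∂P ≤
        (∫ ω, barrierGrad β a (U i ω) ^ 2 ∂P) * (β / 16) := fun i hi => by
    have hi1 : IndepFun (fun ω => barrierGrad β a (U i ω)) (x i) P := by
      rw [IndepFun_iff_Indep]
      exact indep_of_indep_of_le_left (hind i hi)
        (hfc.measurable.comp (measurable_confinedWalk_iSup β a x i)).comap_le
    have hi2 : IndepFun (fun ω => barrierGrad β a (U i ω) ^ 2) (X i) P :=
      hi1.comp (φ := fun y => y ^ 2) (ψ := fun y => y ^ 2 * (1 + |y|) ^ 2)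
        (by fun_prop) (by fun_prop)
    refine ⟨hi2.integrable_mul (hf2 i) (hint i), ?_⟩
    rw [hi2.integral_fun_mul_eq_mul_integral (hf2 i).aestronglyMeasurable
      (hint i).aestronglyMeasurable]
    refine mul_le_mul_of_nonneg_left ?_ (integral_nonneg fun ω => sq_nonneg _)
    linarith [hmom i]
  -- The 16 in `hmom` turns the noise cost `2 / β * f ^ 2 * X` into at most `f ^ 2 / 8` in mean,
  -- matching the reserve from `barrier_descent`, so the sum telescopes.
  have hstep : ∀ i < n, (∫ ω, barrier β a (U (i + 1) ω) ∂P) +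
      (∫ ω, barrierGrad β a (U (i + 1) ω) ^ 2 ∂P) / 8 + (∫ ω, δ i ω ∂P) / 4 ≤
      (∫ ω, barrier β a (U i ω) ∂P) + (∫ ω, barrierGrad β a (U i ω) ^ 2 ∂P) / 8 +
        3 / 16 * (β / a) ^ 2 := fun i hi => by
    obtain ⟨m1, m2⟩ := hmeanU i hi
    obtain ⟨v1, v2⟩ := hXU i hi
    have hpt : ∀ ω, barrier β a (U (i + 1) ω) + barrierGrad β a (U (i + 1) ω) ^ 2 / 8 + δ i ω / 4 ≤
        barrier β a (U i ω) + barrierGrad β a (U i ω) * x i ω +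
          (2 / β * (barrierGrad β a (U i ω) ^ 2 * X i ω) + 3 * (β / a) ^ 2 / β * X i ω) := by
      intro ω
      refine (barrier_descent hβ0 ha (U i ω + x i ω)).trans ?_
      refine (barrier_add_le hβ0 hβ ha0 (U i ω) (x i ω)).trans (le_of_eq ?_)
      rw [hX]; dsimp only; ring
    have hXi : Integrable (X i) P := hint i
    have hA : Integrable (fun ω => barrier β a (U (i + 1) ω) +
      barrierGrad β a (U (i + 1) ω) ^ 2 / 8) P := (hq (i + 1)).add ((hf2 (i + 1)).div_const 8)
    have hB : Integrable (fun ω => barrier β a (U i ω) + barrierGrad β a (U i ω) * x i ω) P :=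
      (hq i).add m1
    have hC : Integrable (fun ω => 2 / β * (barrierGrad β a (U i ω) ^ 2 * X i ω) +
      3 * (β / a) ^ 2 / β * X i ω) P := (v1.const_mul (2 / β)).add (hXi.const_mul _)
    have hI := integral_mono (hA.add ((hδi i).div_const 4)) (hB.add hC) hpt
    simp only [Pi.add_apply] at hI
    rw [integral_add hA ((hδi i).div_const 4),
      integral_add (hq (i + 1)) ((hf2 (i + 1)).div_const 8), integral_div, integral_div,
      integral_add hB hC, integral_add (hq i) m1,
      integral_add (v1.const_mul (2 / β)) (hXi.const_mul _),
      integral_const_mul, integral_const_mul, m2] at hI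
    have b1 : 2 / β * ∫ ω, barrierGrad β a (U i ω) ^ 2 * X i ω ∂P ≤
        (∫ ω, barrierGrad β a (U i ω) ^ 2 ∂P) / 8 := by
      calc _ ≤ 2 / β * ((∫ ω, barrierGrad β a (U i ω) ^ 2 ∂P) * (β / 16)) :=
            mul_le_mul_of_nonneg_left v2 (by positivity)
        _ = _ := by field_simp; ring
    have b2 : 3 * (β / a) ^ 2 / β * ∫ ω, X i ω ∂P ≤ 3 / 16 * (β / a) ^ 2 := by
      calc _ ≤ 3 * (β / a) ^ 2 / β * (β / 16) :=
            mul_le_mul_of_nonneg_left (by linarith [hmom i]) (by positivity)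
        _ = _ := by field_simp
    linarith
  have hsum : ∀ i ≤ n, (∫ ω, barrier β a (U i ω) ∂P) +
      (∫ ω, barrierGrad β a (U i ω) ^ 2 ∂P) / 8 +
      (∑ j ∈ Finset.range i, ∫ ω, δ j ω ∂P) / 4 ≤ barrier β a 0 + i * (3 / 16 * (β / a) ^ 2) := by
    intro i
    induction i with
    | zero => intro _; simp [hU, confinedWalk, barrierGrad_zero]
    | succ i ih =>
      intro hi
      rw [Finset.sum_range_succ]
      push_cast
      linarith [ih (by omega), hstep i (by omega)]
  refine ⟨integrable_finsetSum _ fun i _ => hδi i, ?_⟩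
  rw [integral_finsetSum _ fun i _ => hδi i]
  have h1 : barrier β a 0 ≤ ∫ ω, barrier β a (U n ω) ∂P := by
    have := integral_mono (integrable_const (barrier β a 0)) (hq n)
      fun ω => barrier_zero_le hβ0 (U n ω)
    simpa using this
  have h2 : 0 ≤ ∫ ω, barrierGrad β a (U n ω) ^ 2 ∂P := integral_nonneg fun ω => sq_nonneg _
  have h3 := hsum n le_rfl
  have h4 : 0 ≤ (n : ℝ) * (β / a) ^ 2 := by positivity
  nlinarith

/-- Up to a small multiple of the total variation along the order, the noise pairs with vectors
like a vector of squared norm `O(n / a ^ 2)`. -/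
theorem exists_noise_bound {P : Measure Ω} [IsProbabilityMeasure P] {β a : ℝ}
    (hβ : 1 ≤ β) (ha : 0 < a) {z : ℕ → Ω → ℝ} (hz : ∀ j, Measurable (z j)) {N : ℕ}
    (hind : ∀ i < N + 1, Indep (⨆ j ∈ Set.Iio i, MeasurableSpace.comap (z j) inferInstance)
      (MeasurableSpace.comap (z i) inferInstance) P)
    (hint : ∀ i, Integrable (fun ω => z i ω ^ 2 * (1 + |z i ω|) ^ 2) P)
    (hmom : ∀ i, 16 * ∫ ω, z i ω ^ 2 * (1 + |z i ω|) ^ 2 ∂P ≤ β)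
    (hint1 : ∀ i, Integrable (z i) P) (hmean : ∀ i, ∫ ω, z i ω ∂P = 0) :
    ∃ R : Ω → ℝ, Integrable R P ∧ (∀ ω, 0 ≤ R ω) ∧
      ∫ ω, R ω ∂P ≤ 4 * β ^ 3 * ((N + 1) / a ^ 2) ∧
      ∀ ω, ∀ x : ℕ → ℝ, |∑ i ∈ Finset.range (N + 1), z i ω * x i| ≤
        (√(R ω) + a / √(N + 1 : ℝ)) * √(∑ i ∈ Finset.range (N + 1), x i ^ 2) +
        2 * a * ∑ i ∈ Finset.range N, |x (i + 1) - x i| := by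
  have hβ0 : 0 < β := by linarith
  rcases le_or_gt (8 * √β) a with h8 | h8
  · obtain ⟨h1, h2⟩ := integral_confinedWalk_energy_le hβ h8 hz hind hint hmom hint1 hmean
    refine ⟨_, h1, fun ω => Finset.sum_nonneg fun i _ => sq_nonneg _, h2.trans ?_, fun ω x => ?_⟩
    · push_cast
      have : 0 ≤ β ^ 3 * ((N + 1) / a ^ 2) := by positivity
      calc _ = β ^ 3 * ((N + 1) / a ^ 2) := by ring
        _ ≤ _ := by linarith
    · exact abs_sum_mul_le_of_decomposition (fun i => z i ω) x
        (confinedWalk β a fun j => z j ω) _ rfl (abs_confinedWalk_le hβ0 ha.le _)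
        (fun i => by simp only [confinedWalk]; ring) N
  -- For small `a` no walk is needed: `u = 0` and `δ = z` suffice, since `a ^ 2 ≤ 64 * β`.
  · have hle : ∀ i ω, z i ω ^ 2 ≤ z i ω ^ 2 * (1 + |z i ω|) ^ 2 := fun i ω =>
      le_mul_of_one_le_right (sq_nonneg _) (one_le_pow₀ (by linarith [abs_nonneg (z i ω)]))
    have hsq : ∀ i, Integrable (fun ω => z i ω ^ 2) P := fun i =>
      (hint i).mono' ((hz i).pow_const 2).aestronglyMeasurable <| Eventually.of_forall fun ω => by
        rw [Real.norm_of_nonneg (sq_nonneg _)]; exact hle i ω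
    refine ⟨fun ω => ∑ i ∈ Finset.range (N + 1), z i ω ^ 2, integrable_finsetSum _ fun i _ => hsq i,
      fun ω => Finset.sum_nonneg fun i _ => sq_nonneg _, ?_, fun ω x => ?_⟩
    · rw [integral_finsetSum _ fun i _ => hsq i]
      have h1 : ∑ i ∈ Finset.range (N + 1), ∫ ω, z i ω ^ 2 ∂P ≤
          ∑ i ∈ Finset.range (N + 1), β / 16 := Finset.sum_le_sum fun i _ => by
        have := integral_mono (hsq i) (hint i) (hle i)
        linarith [hmom i]
      rw [Finset.sum_const, Finset.card_range, nsmul_eq_mul] at h1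
      push_cast at h1
      refine h1.trans ?_
      have h2 : a ^ 2 ≤ 64 * β := by
        have := pow_le_pow_left₀ ha.le h8.le 2
        rw [mul_pow, Real.sq_sqrt hβ0.le] at this
        linarith
      rw [← mul_div_assoc (4 * β ^ 3), le_div_iff₀ (pow_pos ha 2)]
      have h3 : β * a ^ 2 ≤ 64 * β ^ 3 := by
        have : β * a ^ 2 ≤ β * (64 * β) := mul_le_mul_of_nonneg_left h2 hβ0.le
        nlinarith [sq_nonneg β]
      have hN : (0 : ℝ) ≤ N + 1 := by positivity
      nlinarith
    · refine abs_sum_mul_le_of_decomposition (fun i => z i ω) x (fun _ => 0)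
        (fun i => z i ω) rfl (fun _ => by simpa using ha.le) (fun i => by simp) N

end Energy

/-! ### Noise on the graph and the deterministic error bound. -/

/-- The layer-cake formula converts the tail bound into a fourth-moment bound whose constant depends
only on `M` and `σ`, hence is uniform in `k`. -/
theorem exists_moment_bound (M σ : ℝ) (hσ : 0 < σ) :
    ∃ K : ℝ, 0 ≤ K ∧ ∀ {Ω V : Type*} [MeasurableSpace Ω] (P : Measure Ω) [IsProbabilityMeasure P]
      (ε : V → Ω → ℝ), IsSubGaussianNoise P M σ ε → ∀ v,
      Integrable (fun ω => ε v ω ^ 4) P ∧ ∫ ω, ε v ω ^ 4 ∂P ≤ K := by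
  set J : ENNReal := ENNReal.ofReal 4 * ∫⁻ s in Set.Ioi (0 : ℝ),
    ENNReal.ofReal (M * Real.exp (-s ^ 2 / (2 * σ ^ 2))) * ENNReal.ofReal (s ^ ((4 : ℝ) - 1)) with hJ
  have hJtop : J < ⊤ := by
    refine ENNReal.mul_lt_top ENNReal.ofReal_lt_top ?_
    have h1 := (integrable_rpow_mul_exp_neg_mul_sq (b := 1 / (2 * σ ^ 2)) (by positivity)
      (s := (4 : ℝ) - 1) (by norm_num)).const_mul |M|
    refine lt_of_le_of_lt (setLIntegral_mono_ae' measurableSet_Ioi (Eventually.of_forall ?_))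
      h1.integrableOn.lintegral_lt_top
    intro s hs
    rw [← ENNReal.ofReal_mul' (Real.rpow_nonneg (le_of_lt hs) _)]
    refine ENNReal.ofReal_le_ofReal ?_
    have e : -s ^ 2 / (2 * σ ^ 2) = -(1 / (2 * σ ^ 2)) * s ^ 2 := by ring
    rw [e]
    have h2 : 0 ≤ s ^ ((4 : ℝ) - 1) * Real.exp (-(1 / (2 * σ ^ 2)) * s ^ 2) :=
      mul_nonneg (Real.rpow_nonneg (le_of_lt hs) _) (Real.exp_pos _).le
    calc _ = M * (s ^ ((4 : ℝ) - 1) * Real.exp (-(1 / (2 * σ ^ 2)) * s ^ 2)) := by ring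
      _ ≤ _ := mul_le_mul_of_nonneg_right (le_abs_self M) h2
  refine ⟨J.toReal, ENNReal.toReal_nonneg, ?_⟩
  intro Ω V _ P _ ε hε v
  have hm : Measurable (ε v) := hε.measurable v
  have hlin : ∫⁻ ω, ENNReal.ofReal (ε v ω ^ 4) ∂P ≤ J := by
    have h := lintegral_rpow_eq_lintegral_meas_lt_mul P (f := fun ω => |ε v ω|)
      (Eventually.of_forall fun ω => abs_nonneg _) (by fun_prop) (p := 4) (by norm_num)
    have e : ∀ ω, |ε v ω| ^ (4 : ℝ) = ε v ω ^ 4 := fun ω => by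
      rw [show (4 : ℝ) = ((4 : ℕ) : ℝ) by norm_num, Real.rpow_natCast]
      exact Even.pow_abs (by decide) _
    simp only [e] at h
    rw [h, hJ]
    refine mul_le_mul_right (setLIntegral_mono_ae' measurableSet_Ioi
      (Eventually.of_forall fun s hs => mul_le_mul_left ?_ _)) _
    rw [← ofReal_measureReal]
    exact ENNReal.ofReal_le_ofReal (hε.tail v s (le_of_lt hs))
  have hnn : 0 ≤ᵐ[P] fun ω => ε v ω ^ 4 := Eventually.of_forall fun ω => by positivity
  have hsm : AEStronglyMeasurable (fun ω => ε v ω ^ 4) P := (hm.pow_const 4).aestronglyMeasurable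
  refine ⟨⟨hsm, ?_⟩, ?_⟩
  · rw [hasFiniteIntegral_iff_ofReal hnn]
    exact hlin.trans_lt hJtop
  · rw [integral_eq_lintegral_of_nonneg_ae hnn hsm]
    exact ENNReal.toReal_mono hJtop.ne hlin

/-- The basic inequality for the fused lasso. -/
theorem IsFusedLasso.basic_inequality {V : Type*} [Fintype V] {G : SimpleGraph V} {lam : ℝ}
    {θ₀ ε θ : V → ℝ} (h : IsFusedLasso G lam (fun v => θ₀ v + ε v) θ) :
    (∑ v, (θ v - θ₀ v) ^ 2) / 2 ≤
      ∑ v, ε v * (θ v - θ₀ v) + lam * (totalVariation G θ₀ - totalVariation G θ) := by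
  have h1 : criterion G lam (fun v => θ₀ v + ε v) θ ≤ criterion G lam (fun v => θ₀ v + ε v) θ₀ :=
    h (Set.mem_univ θ₀)
  unfold criterion at h1
  have e : ∑ v, (θ₀ v + ε v - θ v) ^ 2 = ∑ v, (θ₀ v + ε v - θ₀ v) ^ 2 -
      2 * ∑ v, ε v * (θ v - θ₀ v) + ∑ v, (θ v - θ₀ v) ^ 2 := by
    rw [Finset.mul_sum, ← Finset.sum_sub_distrib, ← Finset.sum_add_distrib]
    exact Finset.sum_congr rfl fun v _ => by ring
  rw [e] at h1
  linarith

theorem exists_graph_noise_bound {Ω V : Type*} [MeasurableSpace Ω] {P : Measure Ω}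
    [IsProbabilityMeasure P] [Fintype V] {G : SimpleGraph V} (hG : G.Connected) {β a : ℝ}
    (hβ : 1 ≤ β) (ha : 0 < a) {ε : V → Ω → ℝ} (hm : ∀ v, Measurable (ε v)) (hind : iIndepFun ε P)
    (hmean : ∀ v, ∫ ω, ε v ω ∂P = 0) (hint : ∀ v, Integrable (fun ω => ε v ω ^ 4) P)
    (hmom : ∀ v, 16 * (1 + 3 * ∫ ω, ε v ω ^ 4 ∂P) ≤ β) :
    ∃ R : Ω → ℝ, Integrable R P ∧ (∀ ω, 0 ≤ R ω) ∧
      ∫ ω, R ω ∂P ≤ 4 * β ^ 3 * (Fintype.card V / a ^ 2) ∧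
      ∀ ω, ∀ θ : V → ℝ, |∑ v, ε v ω * θ v| ≤
        (√(R ω) + a / √(Fintype.card V)) * √(∑ v, θ v ^ 2) + 4 * a * totalVariation G θ := by
  have hex := exists_ordering hG
  obtain ⟨v₀⟩ := hG.nonempty
  obtain ⟨N, hN⟩ : ∃ N, Fintype.card V = N + 1 :=
    ⟨Fintype.card V - 1, by have := Fintype.card_pos_iff.2 ⟨v₀⟩; omega⟩
  rw [hN] at hex ⊢
  obtain ⟨ord, hord⟩ := hex
  -- The order is continued periodically to all of `ℕ`; independence from the past is needed only
  -- for `i < N + 1`.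
  set o : ℕ → V := fun i => ord (Fin.ofNat (N + 1) i) with ho
  have hofin : ∀ i : Fin (N + 1), o i = ord i := fun i => by simp [ho]
  have hoinj : ∀ i < N + 1, ∀ j < N + 1, o i = o j → i = j := fun i hi j hj h => by
    have h1 : o i = ord ⟨i, hi⟩ := hofin ⟨i, hi⟩
    have h2 : o j = ord ⟨j, hj⟩ := hofin ⟨j, hj⟩
    rw [h1, h2] at h
    simpa using ord.injective h
  have hle : ∀ y : ℝ, y ^ 2 * (1 + |y|) ^ 2 ≤ 1 + 3 * y ^ 4 := fun y => by
    have e : y ^ 4 = |y| ^ 4 := (Even.pow_abs (by decide) y).symm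
    rw [e, ← sq_abs y]
    nlinarith [sq_nonneg (|y| ^ 2 - |y|), sq_nonneg (|y| ^ 2 - 1), sq_nonneg (|y|)]
  have hdom : ∀ v, Integrable (fun ω => 1 + 3 * ε v ω ^ 4) P := fun v =>
    (integrable_const _).add ((hint v).const_mul 3)
  have hXi : ∀ v, Integrable (fun ω => ε v ω ^ 2 * (1 + |ε v ω|) ^ 2) P := fun v => by
    have := hm v
    refine (hdom v).mono' (by fun_prop) (Eventually.of_forall fun ω => ?_)
    rw [Real.norm_of_nonneg (by positivity)]
    exact hle _
  have hXb : ∀ v, 16 * ∫ ω, ε v ω ^ 2 * (1 + |ε v ω|) ^ 2 ∂P ≤ β := fun v => by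
    have h1 := integral_mono (hXi v) (hdom v) fun ω => hle _
    rw [integral_add (integrable_const _) ((hint v).const_mul 3), integral_const_mul] at h1
    simp only [integral_const, probReal_univ, smul_eq_mul, one_mul] at h1
    linarith [hmom v]
  have hi1 : ∀ v, Integrable (ε v) P := fun v => by
    refine (hdom v).mono' (hm v).aestronglyMeasurable (Eventually.of_forall fun ω => ?_)
    rw [Real.norm_eq_abs]
    have e : ε v ω ^ 4 = |ε v ω| ^ 4 := (Even.pow_abs (by decide) _).symm
    rw [e]
    nlinarith [sq_nonneg (|ε v ω| ^ 2 - 1 / 2), sq_nonneg (|ε v ω| - 1 / 2)]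
  have hI : ∀ i < N + 1, Indep (⨆ j ∈ Set.Iio i, MeasurableSpace.comap (ε (o j)) inferInstance)
      (MeasurableSpace.comap (ε (o i)) inferInstance) P := fun i hi => by
    have hdisj : Disjoint (o '' Set.Iio i) {o i} := by
      rw [Set.disjoint_singleton_right]
      rintro ⟨j, hj, hji⟩
      have hj' : j < i := hj
      exact hj'.ne (hoinj j (hj'.trans hi) i hi hji)
    have h := indep_iSup_of_disjoint (fun v => (hm v).comap_le)
      ((iIndepFun_iff_iIndep _ _ _).1 hind) hdisj
    rw [iSup_image, iSup_singleton] at h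
    exact h
  obtain ⟨R, hR1, hR2, hR3, hR4⟩ := exists_noise_bound (P := P) hβ ha
    (z := fun i => ε (o i)) (fun i => hm _) hI (fun i => hXi _) (fun i => hXb _)
    (fun i => hi1 _) (fun i => hmean _)
  refine ⟨R, hR1, hR2, by push_cast; exact hR3, fun ω θ => ?_⟩
  have hsum : ∀ g : V → ℝ, ∑ i ∈ Finset.range (N + 1), g (o i) = ∑ v, g v := fun g => by
    rw [Finset.sum_range, ← ord.sum_comp]
    exact Finset.sum_congr rfl fun i _ => by rw [hofin]
  have h1 := hR4 ω fun i => θ (o i)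
  have h2 := hord θ (fun i => θ (o i)) fun i => by rw [hofin]
  rw [hsum fun v => ε v ω * θ v, hsum fun v => θ v ^ 2] at h1
  rw [Nat.add_sub_cancel] at h2
  have h3 := mul_le_mul_of_nonneg_left h2 (show 0 ≤ 2 * a by linarith)
  push_cast
  linarith

/-- The triangle inequality for the total variation cancels that of `θ`, leaving `2 * lam * t`; then
`B * √S ≤ S / 4 + B ^ 2`. -/
theorem IsFusedLasso.sum_sq_le {V : Type*} [Fintype V] {G : SimpleGraph V} {lam t B : ℝ}
    (hlam : 0 ≤ lam) {θ₀ ε θ : V → ℝ} (h : IsFusedLasso G lam (fun v => θ₀ v + ε v) θ)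
    (hθ₀ : θ₀ ∈ BV G t)
    (hnoise : ∑ v, ε v * (θ v - θ₀ v) ≤ B * √(∑ v, (θ v - θ₀ v) ^ 2) +
      lam * totalVariation G fun v => θ v - θ₀ v) :
    ∑ v, (θ v - θ₀ v) ^ 2 ≤ 8 * (lam * t) + 4 * B ^ 2 := by
  have h1 := h.basic_inequality
  have h2 := mul_le_mul_of_nonneg_left (totalVariation_sub_le (G := G) θ θ₀) hlam
  have h3 := mul_le_mul_of_nonneg_left (show totalVariation G θ₀ ≤ t from hθ₀) hlam
  have h4 := Real.sq_sqrt (Finset.sum_nonneg (s := Finset.univ)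
    fun v _ => sq_nonneg (θ v - θ₀ v))
  nlinarith [sq_nonneg (√(∑ v, (θ v - θ₀ v) ^ 2) - 2 * B)]

end

end FusedLasso

/-! ### Rates and conclusion. -/

theorem one_le_sq_mul_pow_four {c w : ℝ} (hc : 1 ≤ c) (hw : 0 < w) (h : 1 ≤ c * w ^ 3) :
    1 ≤ c ^ 2 * w ^ 4 := by
  rcases le_total 1 w with hw1 | hw1
  · exact one_le_mul_of_one_le_of_one_le (one_le_pow₀ hc) (one_le_pow₀ hw1)
  · have h1 : w ^ 3 ≤ w := pow_le_of_le_one hw.le hw1 (by norm_num)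
    have h2 : 1 ≤ c * w := h.trans (mul_le_mul_of_nonneg_left h1 (by linarith))
    calc 1 ≤ (c * w ^ 3) * (c * w) := one_le_mul_of_one_le_of_one_le h h2
      _ = _ := by ring

namespace FusedLasso

/-- Nonasymptotic risk bound for a tuning parameter comparable to `t ^ (-1/3) * n ^ (1/3)`. -/
theorem measureReal_scaledSqNorm_le {Ω V : Type*} [MeasurableSpace Ω] {P : Measure Ω}
    [IsProbabilityMeasure P] [Fintype V] {G : SimpleGraph V} (hG : G.Connected) {β : ℝ}
    (hβ : 1 ≤ β) {ε : V → Ω → ℝ} (hm : ∀ v, Measurable (ε v)) (hind : iIndepFun ε P)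
    (hmean : ∀ v, ∫ ω, ε v ω ∂P = 0) (hint : ∀ v, Integrable (fun ω => ε v ω ^ 4) P)
    (hmom : ∀ v, 16 * (1 + 3 * ∫ ω, ε v ω ^ 4 ∂P) ≤ β)
    {n t lam c₁ c₂ c₃ η : ℝ} (hn : n = Fintype.card V) (ht : 0 < t) (hlam : 0 ≤ lam)
    (hc₁ : 0 < c₁) (hc₂ : 0 < c₂) (hc₃ : 1 ≤ c₃) (hη : 0 < η)
    (h₁ : t ^ (-1 / 3 : ℝ) * n ^ (1 / 3 : ℝ) ≤ c₁ * lam)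
    (h₂ : lam ≤ c₂ * (t ^ (-1 / 3 : ℝ) * n ^ (1 / 3 : ℝ)))
    (h₃ : n ^ (-1 / 2 : ℝ) ≤ c₃ * t)
    {θ₀ : V → ℝ} (hθ₀ : θ₀ ∈ BV G t) {θ : Ω → V → ℝ}
    (hθ : ∀ ω, IsFusedLasso G lam (fun v => θ₀ v + ε v ω) (θ ω)) :
    P.real {ω | 8 * c₂ + c₂ ^ 2 * c₃ ^ 2 / 2 + 8 * (64 * β ^ 3 * c₁ ^ 2 / η) <
      |scaledSqNorm (fun v => θ ω v - θ₀ v) / (t ^ (2 / 3 : ℝ) * n ^ (-2 / 3 : ℝ))|} ≤ η := by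
  obtain ⟨v₀⟩ := hG.nonempty
  have hn0 : 0 < n := by rw [hn]; exact_mod_cast Fintype.card_pos_iff.2 ⟨v₀⟩
  -- With `t = p ^ 3` and `n = m ^ 6` all rates become integer powers: `lam` is of order `m ^ 2 /
  -- p`, and the target for the unscaled squared error is `(p * m) ^ 2`.
  obtain ⟨p, hp, hp3⟩ : ∃ p : ℝ, 0 < p ∧ t = p ^ (3 : ℝ) :=
    ⟨t ^ (1 / 3 : ℝ), by positivity, by rw [← Real.rpow_mul ht.le]; norm_num⟩
  obtain ⟨m, hm0, hm6⟩ : ∃ m : ℝ, 0 < m ∧ n = m ^ (6 : ℝ) :=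
    ⟨n ^ (1 / 6 : ℝ), by positivity, by rw [← Real.rpow_mul hn0.le]; norm_num⟩
  have e1 : t ^ (-1 / 3 : ℝ) = p⁻¹ := by
    rw [hp3, ← Real.rpow_mul hp.le, ← Real.rpow_neg_one]; norm_num
  have e2 : n ^ (1 / 3 : ℝ) = m ^ 2 := by
    rw [hm6, ← Real.rpow_mul hm0.le, ← Real.rpow_natCast]; norm_num
  have e3 : n ^ (-1 / 2 : ℝ) = (m ^ 3)⁻¹ := by
    rw [hm6, ← Real.rpow_mul hm0.le, ← Real.rpow_natCast, ← Real.rpow_neg hm0.le]; norm_num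
  have e4 : t ^ (2 / 3 : ℝ) = p ^ 2 := by
    rw [hp3, ← Real.rpow_mul hp.le, ← Real.rpow_natCast]; norm_num
  have e5 : n ^ (-2 / 3 : ℝ) = (m ^ 4)⁻¹ := by
    rw [hm6, ← Real.rpow_mul hm0.le, ← Real.rpow_natCast, ← Real.rpow_neg hm0.le]; norm_num
  have e6 : t = p ^ 3 := by rw [hp3, ← Real.rpow_natCast]; norm_num
  have e7 : n = m ^ 6 := by rw [hm6, ← Real.rpow_natCast]; norm_num
  rw [e1, e2] at h₁ h₂
  rw [e3, e6] at h₃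
  rw [e4, e5]
  have hw : 1 ≤ c₃ ^ 2 * (p * m) ^ 4 := by
    refine one_le_sq_mul_pow_four hc₃ (mul_pos hp hm0) ?_
    rw [inv_le_iff_one_le_mul₀ (by positivity)] at h₃
    calc 1 ≤ _ := h₃
      _ = _ := by ring
  have hlam0 : 0 < lam := by
    refine pos_of_mul_pos_right (lt_of_lt_of_le ?_ h₁) hc₁.le
    positivity
  -- The level `lam / 4` makes the variation coefficient `4 * a` equal to `lam`.
  obtain ⟨R, hR1, hR2, hR3, hR4⟩ := exists_graph_noise_bound hG hβ
    (show 0 < lam / 4 by linarith) hm hind hmean hint hmom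
  rw [← hn] at hR3 hR4
  have hlamt : lam * t ≤ c₂ * (p * m) ^ 2 := by
    rw [e6]
    calc lam * p ^ 3 ≤ c₂ * (p⁻¹ * m ^ 2) * p ^ 3 := mul_le_mul_of_nonneg_right h₂ (by positivity)
      _ = _ := by field_simp
  have hlamn : lam ^ 2 / n ≤ c₂ ^ 2 * c₃ ^ 2 * (p * m) ^ 2 := by
    rw [e7, div_le_iff₀ (by positivity)]
    calc lam ^ 2 ≤ (c₂ * (p⁻¹ * m ^ 2)) ^ 2 := pow_le_pow_left₀ hlam h₂ 2
      _ = c₂ ^ 2 * m ^ 4 / p ^ 2 * 1 := by field_simp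
      _ ≤ c₂ ^ 2 * m ^ 4 / p ^ 2 * (c₃ ^ 2 * (p * m) ^ 4) :=
        mul_le_mul_of_nonneg_left hw (by positivity)
      _ = _ := by field_simp
  have hER : ∫ ω, R ω ∂P ≤ 64 * β ^ 3 * c₁ ^ 2 * (p * m) ^ 2 := by
    have h4 : n / (lam / 4) ^ 2 ≤ 16 * c₁ ^ 2 * (p * m) ^ 2 := by
      rw [e7, div_le_iff₀ (by positivity)]
      have h5 : m ^ 2 ≤ c₁ * lam * p := by
        rwa [inv_mul_le_iff₀ hp, mul_comm p] at h₁
      calc m ^ 6 = m ^ 2 * (m ^ 2) ^ 2 := by ring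
        _ ≤ m ^ 2 * (c₁ * lam * p) ^ 2 := by gcongr
        _ = _ := by ring
    have h6 := mul_le_mul_of_nonneg_left h4 (show 0 ≤ 4 * β ^ 3 by positivity)
    linarith
  have hdet : ∀ ω, ∑ v, (θ ω v - θ₀ v) ^ 2 ≤
      (8 * c₂ + c₂ ^ 2 * c₃ ^ 2 / 2) * (p * m) ^ 2 + 8 * R ω := fun ω => by
    have h4 := (hθ ω).sum_sq_le hlam hθ₀ (B := √(R ω) + lam / 4 / √n) <|
      (le_abs_self _).trans ((hR4 ω fun v => θ ω v - θ₀ v).trans (le_of_eq (by ring)))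
    have h5 : (√(R ω) + lam / 4 / √n) ^ 2 ≤ 2 * R ω + lam ^ 2 / n / 8 := by
      have h6 : (lam / 4 / √n) ^ 2 = lam ^ 2 / n / 16 := by
        rw [div_pow, div_pow, Real.sq_sqrt hn0.le]; ring
      have h7 := Real.sq_sqrt (hR2 ω)
      nlinarith [sq_nonneg (√(R ω) - lam / 4 / √n)]
    linarith
  have hL : 0 < 64 * β ^ 3 * c₁ ^ 2 / η * (p * m) ^ 2 := by positivity
  -- Markov's inequality at the bound for the mean of `R` divided by `η`.
  have hmarkov := mul_meas_ge_le_integral_of_nonneg (Eventually.of_forall hR2) hR1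
    (64 * β ^ 3 * c₁ ^ 2 / η * (p * m) ^ 2)
  refine (measureReal_mono (fun ω hω => ?_)).trans
    (le_of_mul_le_mul_left (hmarkov.trans (hER.trans (le_of_eq (by field_simp)))) hL)
  rw [Set.mem_ofPred_eq] at hω ⊢
  have h4 : scaledSqNorm (fun v => θ ω v - θ₀ v) / (p ^ 2 * (m ^ 4)⁻¹) =
      (∑ v, (θ ω v - θ₀ v) ^ 2) / (p * m) ^ 2 := by
    unfold scaledSqNorm
    rw [← hn, e7]
    field_simp
  rw [h4, abs_of_nonneg (div_nonneg (Finset.sum_nonneg fun v _ => sq_nonneg _) (by positivity)),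
    lt_div_iff₀ (by positivity)] at hω
  linarith [hdet ω]

end FusedLasso

theorem theorem2
    {Ω : ℕ → Type*} [∀ k, MeasurableSpace (Ω k)]
    (P : ∀ k, Measure (Ω k)) [∀ k, IsProbabilityMeasure (P k)]
    {V : ℕ → Type*} [∀ k, Fintype (V k)]
    (G : ∀ k, SimpleGraph (V k)) (hG : ∀ k, (G k).Connected)
    (n : ℕ → ℝ) (hn : ∀ k, n k = (Fintype.card (V k) : ℝ))
    (M σ : ℝ) (hM : 0 < M) (hσ : 0 < σ)
    (ε : ∀ k, V k → Ω k → ℝ) (hε : ∀ k, FusedLasso.IsSubGaussianNoise (P k) M σ (ε k))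
    (t : ℕ → ℝ) (ht : ∀ k, 0 < t k)
    (htn : (fun k => n k ^ (-1 / 2 : ℝ)) =O[atTop] t)
    (θ₀ : ∀ k, V k → ℝ) (hθ₀ : ∀ k, θ₀ k ∈ FusedLasso.BV (G k) (t k))
    (lam : ℕ → ℝ) (hlam : ∀ k, 0 ≤ lam k)
    (hlam_rate : lam =Θ[atTop] fun k => t k ^ (-1 / 3 : ℝ) * n k ^ (1 / 3 : ℝ))
    (θhat : ∀ k, Ω k → V k → ℝ)
    (hθhat : ∀ k ω, FusedLasso.IsFusedLasso (G k) (lam k)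
      (fun v => θ₀ k v + ε k v ω) (θhat k ω)) :
    FusedLasso.IsBigOP P
      (fun k ω => FusedLasso.scaledSqNorm (fun v => θhat k ω v - θ₀ k v))
      (fun k => t k ^ (2 / 3 : ℝ) * n k ^ (-2 / 3 : ℝ)) := by

  obtain ⟨K, hK0, hK⟩ := FusedLasso.exists_moment_bound M σ hσ
  obtain ⟨c₃, hc₃, h₃⟩ := htn.exists_pos
  obtain ⟨c₂, hc₂, h₂⟩ := hlam_rate.1.exists_pos
  obtain ⟨c₁, hc₁, h₁⟩ := hlam_rate.2.exists_pos
  intro η hη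
  refine ⟨8 * c₂ + c₂ ^ 2 * max 1 c₃ ^ 2 / 2 + 8 * (64 * (16 * (1 + 3 * K)) ^ 3 * c₁ ^ 2 / η),
    by positivity, ?_⟩
  filter_upwards [h₁.bound, h₂.bound, h₃.bound] with k h₁ h₂ h₃
  have hn0 : 0 ≤ n k := by rw [hn]; positivity
  have hρ : 0 ≤ t k ^ (-1 / 3 : ℝ) * n k ^ (1 / 3 : ℝ) :=
    mul_nonneg (Real.rpow_nonneg (ht k).le _) (Real.rpow_nonneg hn0 _)
  rw [Real.norm_of_nonneg hρ, Real.norm_of_nonneg (hlam k)] at h₁ h₂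
  rw [Real.norm_of_nonneg (Real.rpow_nonneg hn0 _), Real.norm_of_nonneg (ht k).le] at h₃
  exact FusedLasso.measureReal_scaledSqNorm_le (hG k) (by linarith) (hε k).measurable
    (hε k).indep (hε k).mean_zero (fun v => (hK (P k) (ε k) (hε k) v).1)
    (fun v => by linarith [(hK (P k) (ε k) (hε k) v).2]) (hn k) (ht k) (hlam k) hc₁ hc₂
    (le_max_left _ _) hη h₁ h₂
    (h₃.trans (mul_le_mul_of_nonneg_right (le_max_right _ _) (ht k).le)) (hθ₀ k) (hθhat k)
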